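/- Trees are connected acyclic simple graphs. An embedding of a tree $T$ into a tree $S$ is an injective map of vertex sets that preserves adjacency; an embedding of $T$ is an embedding of $T$ into itself. Two trees are siblings if each embeds into the other, and $Sib(T)$ is the number of isomorphism classes of siblings of $T$, where $Sib(T)=\infty$ means that there are infinitely many. A ray is a one-way infinite path. Two rays in $T$ are equivalent if their intersection is again a ray, and the ends of $T$ are the equivalence classes of rays. An embedding $g$ of $T$ fixes an end $\eta$ if $g(R)\in\eta$ for every ray $R\in\eta$. It is elliptic if $g(F)=F$ for some non-empty finite subtree $F$ of $T$, and hyperbolic if it is not elliptic and fixes precisely two ends of $T$. **Corollary.** Let $T$ be a locally finite tree that has no hyperbolic embedding. Then 1. (Bonato--Tardif) $Sib(T)=1$ or $Sib(T)=\infty$; 2. (Tyomkyn) if $T$ has a non-surjective embedding and $T$ is not a ray, then $Sib(T)=\infty$. -/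

import Mathlib

universe u

namespace TreeSiblings

variable {V : Type u}

/-- An embedding of `T`: an injective, adjacency preserving self-map of the vertex set. -/
abbrev Emb (T : SimpleGraph V) : Type u := T.Copy T

/-- The one-way infinite path `0 - 1 - 2 - ...`. -/
abbrev rayGraph : SimpleGraph ℕ := SimpleGraph.hasse ℕ

/-- `T` is (isomorphic to) a ray. -/
def IsRay (T : SimpleGraph V) : Prop := Nonempty (T ≃g rayGraph)

/-- The rays contained in `T`, each parametrized from its first vertex. -/
abbrev Ray (T : SimpleGraph V) : Type u := rayGraph.Copy T

/-- Two rays are equivalent if their intersection is again a ray. (In a tree, a ray is determined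
by its set of vertices.) -/
def RayEquiv {T : SimpleGraph V} (R S : Ray T) : Prop :=
  ∃ Q : Ray T, Set.range Q = Set.range R ∩ Set.range S

/-- The set `Ω(T)` of ends of `T`: the equivalence classes of rays. -/
def ends (T : SimpleGraph V) : Set (Set (Ray T)) :=
  {η | ∃ R : Ray T, η = {S | RayEquiv R S}}

/-- The ends `η` fixed by `g`: the images under `g` of the rays in `η` are again in `η`. -/
def fixedEnds {T : SimpleGraph V} (g : Emb T) : Set (Set (Ray T)) :=
  {η | η ∈ ends T ∧ ∀ R ∈ η, g.comp R ∈ η}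

/-- `g` is elliptic: it fixes (as a set) some non-empty finite subtree of `T`. A subtree of a tree
is given by its vertex set; `Connected` includes non-emptiness. -/
def IsElliptic {T : SimpleGraph V} (g : Emb T) : Prop :=
  ∃ F : Set V, F.Finite ∧ (T.induce F).Connected ∧ g '' F = F

/-- `g` is hyperbolic: it is not elliptic and it fixes precisely two ends. -/
def IsHyperbolic {T : SimpleGraph V} (g : Emb T) : Prop :=
  ¬ IsElliptic g ∧ (fixedEnds g).encard = 2

/-- Mutual embeddability of two graphs. -/
def Equimorphic {W : Type u} (T : SimpleGraph V) (S : SimpleGraph W) : Prop :=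
  Nonempty (T.Copy S) ∧ Nonempty (S.Copy T)

/-- A sibling of `T`: a tree equimorphic to `T`. A sibling embeds in `T`, so up to isomorphism all
of them have their vertex types in the universe of `V`. -/
structure Sibling (T : SimpleGraph V) where
  Vert : Type u
  graph : SimpleGraph Vert
  isTree : graph.IsTree
  equimorphic : Equimorphic T graph

/-- Isomorphism of siblings. -/
def siblingSetoid (T : SimpleGraph V) : Setoid (Sibling T) where
  r A B := Nonempty (A.graph ≃g B.graph)
  iseqv :=
    { refl := fun _ => ⟨SimpleGraph.Iso.refl⟩
      symm := fun ⟨e⟩ => ⟨e.symm⟩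
      trans := fun ⟨e⟩ ⟨e'⟩ => ⟨e'.comp e⟩ }

/-- The sibling number `Sib(T)`: the number of isomorphism classes of siblings of `T`, with value
`⊤` if there are infinitely many. -/
noncomputable def Sib (T : SimpleGraph V) : ℕ∞ :=
  ENat.card (Quotient (siblingSetoid T))

end TreeSiblings

/-!
Let `f` be a non-surjective embedding of the locally finite tree `T`. A finite set `F` with
`f '' F = F` would make `f` a permutation of every ball around `F`, so `f` is not elliptic
(`no_finite_invariant`). If some vertex lay in the image of every iterate of `f`, then `f` would
restrict to an automorphism of the subtree `⋂ n, range f^[n]`, a translation along an axis, and the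
two ends of the axis would be the only fixed ends (`fixedEnds_encard`). So without hyperbolic
embeddings the images of the iterates have empty intersection, and by local finiteness they shrink
to an end: there is a ray `R` such that each set of vertices beyond `R n` contains the image of an
iterate of `f` (`exists_attracting_ray`). Consequently every subtree of `T` that contains
everything beyond some `R n` is a sibling of `T`. If `T` is not a ray, then infinitely many branches
leave `R` (`exists_branch`), and two cases remain.

* Some ray that is not eventually in `R` has infinitely many branch vertices. Everything beyond a
  vertex of this ray can be replaced by the ray with an arbitrary set of teeth (single vertices
  attached to it), which gives uncountably many siblings that are pairwise non-isomorphic as trees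
  with two marked vertices. A countable tree has only countably many markings, so there are
  infinitely many siblings (`sib_eq_top_of_comb`).
* Otherwise the end of `R` is the only one whose rays have infinitely many branch vertices. Thin
  out `T` to the subtree `thinned R n` consisting of `R` and everything beyond `R (n + 1)`. An
  isomorphism between two of these preserves the end of `R`, so it eventually translates `R`
  (`exists_translation_of_iso`). It then matches the sphere sizes around far away vertices of `R`,
  taken on the side of `R` away from its end. These sphere sizes satisfy a recursion along `R` whose
  increments are the sphere sizes of the trees hanging off `R`. The translation preserves the
  increments far out, hence, if `n` is beyond the preperiod of the sequence of increments,
  everywhere where they matter (`exists_uniform_period`), and the recursion can be run backwards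
  until it reaches the thinned out initial paths, which have different lengths
  (`sphere_size_injective`, `sib_eq_top_of_thin`).

If every embedding of `T` is surjective, or if `T` is a ray, all siblings are isomorphic.

Trees are handled through `SimpleGraph.dist`: with a root `r` fixed, each vertex other than `r` has
exactly one neighbour closer to `r`, its parent.
-/

namespace TreeSiblings

section

variable {V : Type*} {T : SimpleGraph V}

/-! ### Distances in trees -/

theorem dist_tri (hT : T.IsTree) (a b c : V) : T.dist a c ≤ T.dist a b + T.dist b c :=
  hT.connected.dist_triangle

theorem dist_eq_zero (hT : T.IsTree) {a b : V} (h : T.dist a b = 0) : a = b :=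
  hT.connected.dist_eq_zero_iff.1 h

theorem adj_of_dist {a b : V} (h : T.dist a b = 1) : T.Adj a b :=
  SimpleGraph.dist_eq_one_iff_adj.1 h

theorem dist_of_adj {a b : V} (h : T.Adj a b) : T.dist a b = 1 :=
  SimpleGraph.dist_eq_one_iff_adj.2 h

theorem dist_step (hT : T.IsTree) (r : V) {a b : V} (h : T.Adj a b) :
    T.dist r a = T.dist r b + 1 ∨ T.dist r b = T.dist r a + 1 :=
  hT.dist_eq_dist_add_one_of_adj r h

theorem exists_parent (hT : T.IsTree) {r w : V} {k : ℕ} (h : T.dist r w = k + 1) :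
    ∃ p, T.Adj p w ∧ T.dist r p = k := by
  obtain ⟨p, hp⟩ := hT.connected.exists_walk_length_eq_dist w r
  rw [SimpleGraph.dist_comm, h] at hp
  cases p with
  | nil => simp at hp
  | cons hadj q =>
    rename_i v
    refine ⟨v, hadj.symm, ?_⟩
    have h1 : T.dist v r ≤ q.length := SimpleGraph.dist_le q
    have h2 := dist_tri hT r v w
    rw [dist_of_adj hadj.symm] at h2
    simp at hp
    rw [SimpleGraph.dist_comm] at h1
    omega

theorem parent_unique (hT : T.IsTree) {r w a b : V} (ha : T.Adj a w) (hb : T.Adj b w)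
    (hra : T.dist r a + 1 = T.dist r w) (hrb : T.dist r b + 1 = T.dist r w) : a = b := by
  obtain ⟨p, hp, hpl⟩ := hT.connected.exists_path_of_dist r a
  obtain ⟨q, hq, hql⟩ := hT.connected.exists_path_of_dist r b
  have key : ∀ {c : V} (s : T.Walk r c) (hc : T.Adj c w), s.IsPath → s.length = T.dist r c →
      T.dist r c + 1 = T.dist r w → (s.concat hc).IsPath := by
    intro c s hc hs hl hd
    apply SimpleGraph.Walk.isPath_of_length_eq_dist
    rw [SimpleGraph.Walk.length_concat, hl, hd]
  have h := (hT.isAcyclic.subsingleton_path r w).elim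
    ⟨_, key p ha hp hpl hra⟩ ⟨_, key q hb hq hql hrb⟩
  have h2 := congrArg (fun x : T.Path r w => x.1.penultimate) h
  simpa using h2

/-- Geodesics do not turn back: two consecutive steps that do not backtrack and start away
from `v` continue away from `v`. -/
theorem dist_no_turn (hT : T.IsTree) {v a b c : V} (hab : T.Adj a b) (hbc : T.Adj b c)
    (hac : a ≠ c) (h : T.dist v b = T.dist v a + 1) : T.dist v c = T.dist v b + 1 := by
  rcases dist_step hT v hbc with h1 | h1
  · exact absurd (parent_unique hT hab hbc.symm h.symm h1.symm) hac
  · exact h1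

theorem exists_ancestor (hT : T.IsTree) (r w : V) {n : ℕ} (h : n ≤ T.dist r w) :
    ∃ u, T.dist r u = n ∧ n + T.dist u w = T.dist r w := by
  obtain ⟨k, hk⟩ := Nat.exists_eq_add_of_le h
  induction k generalizing w with
  | zero => exact ⟨w, by omega, by simp; omega⟩
  | succ k ih =>
    obtain ⟨p, hp, hpd⟩ := exists_parent hT (r := r) (w := w) (k := n + k) (by omega)
    obtain ⟨u, hu, hu'⟩ := ih p (by omega) hpd
    refine ⟨u, hu, ?_⟩
    have h1 := dist_tri hT u p w
    have h2 := dist_tri hT r u w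
    rw [dist_of_adj hp] at h1
    omega

theorem ancestor_unique (hT : T.IsTree) {r u u' w : V} (h : T.dist r u + T.dist u w = T.dist r w)
    (h' : T.dist r u' + T.dist u' w = T.dist r w) (he : T.dist r u = T.dist r u') : u = u' := by
  obtain ⟨k, hk⟩ : ∃ k, T.dist u w = k := ⟨_, rfl⟩
  induction k generalizing w with
  | zero =>
    rw [dist_eq_zero hT hk, dist_eq_zero hT (show T.dist u' w = 0 by omega)]
  | succ k ih =>
    obtain ⟨p, hp, hpd⟩ := exists_parent hT (r := u) (w := w) hk
    obtain ⟨q, hq, hqd⟩ := exists_parent hT (r := u') (w := w) (k := k) (by omega)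
    have h1 := dist_tri hT r u p
    have h2 := dist_tri hT r u' q
    have h3 := dist_tri hT r p w
    have h4 := dist_tri hT r q w
    rw [dist_of_adj hp] at h3
    rw [dist_of_adj hq] at h4
    obtain rfl := parent_unique hT hp hq (r := r) (by omega) (by omega)
    exact ih (by omega) (by omega) hpd

/-- The vertex `u` lies on the geodesic from `r` to `w`; when `r` is thought of as a root, `w` is
a descendant of `u`. -/
def Btw (T : SimpleGraph V) (r u w : V) : Prop := T.dist r u + T.dist u w = T.dist r w

theorem Btw.trans (hT : T.IsTree) {r u v w : V} (h : Btw T r u v) (h' : Btw T r v w) :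
    Btw T r u w := by
  unfold Btw at *
  have h1 := dist_tri hT u v w
  have h2 := dist_tri hT r u w
  omega

theorem Btw.self (r u : V) : Btw T r u u := by simp [Btw]

/-- Of two ancestors of `w`, the one closer to the root is an ancestor of the other. -/
theorem Btw.comparable (hT : T.IsTree) {r u v w : V} (hu : Btw T r u w) (hv : Btw T r v w)
    (h : T.dist r u ≤ T.dist r v) : Btw T r u v := by
  obtain ⟨x, hx, hx'⟩ := exists_ancestor hT r v h
  have hx2 : Btw T r x v := by unfold Btw; omega
  obtain rfl := ancestor_unique hT (hx2.trans hT hv) hu hx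
  exact hx2

/-- Apart from `u` itself, the descendants of `u` have their parents among the descendants of
`u`. -/
theorem Btw.of_child (hT : T.IsTree) {r u p w : V} (hpw : T.Adj p w)
    (hd : T.dist r w = T.dist r p + 1) (h : Btw T r u w) (hne : u ≠ w) : Btw T r u p := by
  have hp : Btw T r p w := by unfold Btw; rw [dist_of_adj hpw]; omega
  refine h.comparable hT hp ?_
  have : T.dist u w ≠ 0 := fun h0 => hne (dist_eq_zero hT h0)
  unfold Btw at h
  omega

theorem Btw.child (hT : T.IsTree) {r u p w : V} (hpw : T.Adj p w)
    (hd : T.dist r w = T.dist r p + 1) (h : Btw T r u p) : Btw T r u w :=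
  h.trans hT (by unfold Btw; rw [dist_of_adj hpw]; omega)

/-- An injective homomorphism of a tree into a tree is isometric. -/
theorem copy_dist {W : Type*} {S : SimpleGraph W} (hT : T.IsTree) (hS : S.IsTree) (f : T.Copy S)
    (a b : V) : S.dist (f a) (f b) = T.dist a b := by
  obtain ⟨k, hk⟩ : ∃ k, T.dist a b = k := ⟨_, rfl⟩
  have hadj : ∀ {x y : V}, T.Adj x y → S.Adj (f x) (f y) := fun h => f.toHom.map_adj h
  induction k using Nat.strong_induction_on generalizing b with
  | _ k ih =>
    rcases k with _ | _ | k
    · rw [dist_eq_zero hT hk]; simp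
    · rw [hk, dist_of_adj (hadj (adj_of_dist hk))]
    · obtain ⟨p, hp, hpd⟩ := exists_parent hT hk
      obtain ⟨q, hq, hqd⟩ := exists_parent hT hpd
      have h1 := ih _ (by omega) p hpd
      have h2 := ih _ (by omega) q hqd
      have := dist_no_turn hS (v := f a) (hadj hq) (hadj hp)
        (fun h => by have := f.injective h; subst this; omega) (by omega)
      omega

theorem copy_adj {W : Type*} {S : SimpleGraph W} (hT : T.IsTree) (hS : S.IsTree) (f : T.Copy S)
    {a b : V} : S.Adj (f a) (f b) ↔ T.Adj a b := by
  rw [← SimpleGraph.dist_eq_one_iff_adj, ← SimpleGraph.dist_eq_one_iff_adj, copy_dist hT hS]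

/-- A bijective embedding between trees is an isomorphism. -/
theorem iso_of_surjective {W : Type*} {S : SimpleGraph W} (hT : T.IsTree) (hS : S.IsTree)
    (f : T.Copy S) (hf : Function.Surjective f) : ∃ e : T ≃g S, ∀ v, e v = f v :=
  ⟨⟨Equiv.ofBijective f ⟨f.injective, hf⟩, copy_adj hT hS f⟩, fun _ => rfl⟩

theorem copy_map_adj {W : Type*} {S : SimpleGraph W} (f : T.Copy S) {a b : V} (h : T.Adj a b) :
    S.Adj (f a) (f b) := f.toHom.map_adj h

theorem exists_iterate_copy (f : T.Copy T) (n : ℕ) : ∃ g : T.Copy T, ⇑g = f^[n] := by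
  induction n with
  | zero => exact ⟨.id T, by simp⟩
  | succ n ih =>
    obtain ⟨g, hg⟩ := ih
    exact ⟨g.comp f, by rw [SimpleGraph.Copy.coe_comp, hg, Function.iterate_succ]⟩

theorem dist_iterate (hT : T.IsTree) (f : T.Copy T) (n : ℕ) (a b : V) :
    T.dist (f^[n] a) (f^[n] b) = T.dist a b := by
  obtain ⟨g, hg⟩ := exists_iterate_copy f n
  rw [← hg, copy_dist hT hT]

theorem finite_ball [T.LocallyFinite] (hT : T.IsTree) (r : V) (n : ℕ) :
    {w | T.dist r w ≤ n}.Finite := by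
  induction n with
  | zero =>
    refine (Set.finite_singleton r).subset fun w hw => ?_
    exact (dist_eq_zero hT (Nat.le_zero.1 hw)).symm
  | succ n ih =>
    refine (ih.union (ih.biUnion fun v _ => (T.neighborSet v).toFinite)).subset fun w hw => ?_
    rcases Nat.lt_or_ge n (T.dist r w) with h | h
    · obtain ⟨p, hp, hpd⟩ := exists_parent hT (show T.dist r w = n + 1 from le_antisymm hw h)
      exact Or.inr (Set.mem_biUnion (show p ∈ {w | T.dist r w ≤ n} from hpd.le) hp)
    · exact Or.inl h

theorem countable_of_locallyFinite [T.LocallyFinite] (hT : T.IsTree) : Countable V := by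
  obtain ⟨r⟩ := hT.connected.nonempty
  rw [← Set.countable_univ_iff]
  refine (Set.countable_iUnion fun n => (finite_ball hT r n).countable).mono fun w _ => ?_
  exact Set.mem_iUnion.2 ⟨T.dist r w, show T.dist r w ≤ T.dist r w from le_rfl⟩

/-- A set of vertices containing `r` and closed under passing to the neighbour towards `r` spans
a subtree. -/
theorem induce_isTree (hT : T.IsTree) {r : V} {X : Set V} (hr : r ∈ X)
    (hX : ∀ p w, T.Adj p w → T.dist r w = T.dist r p + 1 → w ∈ X → p ∈ X) :
    (T.induce X).IsTree := by
  refine ⟨?_, hT.isAcyclic.induce X⟩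
  have key : ∀ (k : ℕ) (w : V) (hw : w ∈ X), T.dist r w = k →
      (T.induce X).Reachable ⟨r, hr⟩ ⟨w, hw⟩ := by
    intro k
    induction k with
    | zero =>
      intro w hw h
      obtain rfl := dist_eq_zero hT h
      exact SimpleGraph.Reachable.refl _
    | succ k ih =>
      intro w hw h
      obtain ⟨p, hp, hpd⟩ := exists_parent hT h
      have hpX := hX p w hp (by omega) hw
      refine (ih p hpX hpd).trans (SimpleGraph.Adj.reachable ?_)
      simpa using hp
  refine (SimpleGraph.connected_iff_exists_forall_reachable _).2 ⟨⟨r, hr⟩, fun w => ?_⟩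
  exact key _ w.1 w.2 rfl

theorem induce_dist (hT : T.IsTree) {X : Set V} (hX : (T.induce X).IsTree) (a b : X) :
    (T.induce X).dist a b = T.dist a.1 b.1 :=
  (copy_dist hX hT (SimpleGraph.Copy.induce T X) a b).symm

theorem adj_rayGraph {a b : ℕ} : rayGraph.Adj a b ↔ a + 1 = b ∨ b + 1 = a := by
  simp [SimpleGraph.hasse_adj, Nat.covBy_iff_add_one_eq]

/-- A sequence that moves away from a vertex at unit speed is a ray. -/
def rayOfDist (z : ℕ → V) (hz : ∀ n, T.Adj (z n) (z (n + 1))) (r : V) (d : ℕ)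
    (h : ∀ n, T.dist r (z n) = d + n) : rayGraph.Copy T :=
  ⟨⟨z, fun {a b} hab => by
    rcases adj_rayGraph.1 hab with rfl | rfl
    · exact hz _
    · exact (hz _).symm⟩, fun a b hab => by
      have h1 := congrArg (T.dist r) hab
      have h2 := h a
      have h3 := h b
      change T.dist r (z a) = T.dist r (z b) at h1
      omega⟩

theorem dist_of_no_backtrack (hT : T.IsTree) {z : ℕ → V} (hz : ∀ n, T.Adj (z n) (z (n + 1)))
    (hb : ∀ n, z n ≠ z (n + 2)) (n : ℕ) : T.dist (z 0) (z n) = n := by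
  have key : ∀ n, T.dist (z 0) (z (n + 1)) = T.dist (z 0) (z n) + 1 := by
    intro n
    induction n with
    | zero => simp [dist_of_adj (hz 0)]
    | succ n ih => exact dist_no_turn hT (hz n) (hz (n + 1)) (hb n) ih
  induction n with
  | zero => simp
  | succ n ih => rw [key, ih]

theorem ray_adj (R : rayGraph.Copy T) (n : ℕ) : T.Adj (R n) (R (n + 1)) :=
  copy_map_adj R (adj_rayGraph.2 (Or.inl rfl))

/-- Every ray eventually moves away from a given vertex at unit speed. -/
theorem exists_ray_away (hT : T.IsTree) (R : rayGraph.Copy T) (v : V) :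
    ∃ N, ∀ s, T.dist v (R (N + s)) = T.dist v (R N) + s := by
  have hup : ∃ N, T.dist v (R (N + 1)) = T.dist v (R N) + 1 := by
    by_contra! h
    have key : ∀ n, T.dist v (R n) + n = T.dist v (R 0) := by
      intro n
      induction n with
      | zero => rfl
      | succ n ih =>
        rcases dist_step hT v (ray_adj R n) with h1 | h1
        · omega
        · exact absurd h1 (h n)
    have := key (T.dist v (R 0) + 1)
    omega
  obtain ⟨N, hN⟩ := hup
  have key : ∀ s, T.dist v (R (N + s + 1)) = T.dist v (R (N + s)) + 1 := by
    intro s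
    induction s with
    | zero => exact hN
    | succ s ih =>
      exact dist_no_turn hT (ray_adj R (N + s)) (ray_adj R (N + s + 1))
        (fun h => by have := R.injective h; omega) ih
  refine ⟨N, fun s => ?_⟩
  induction s with
  | zero => rfl
  | succ s ih => rw [← add_assoc, key, ih, add_assoc]

theorem ray_dist (hT : T.IsTree) (R : rayGraph.Copy T) (a n : ℕ) :
    T.dist (R a) (R (a + n)) = n := by
  have := dist_of_no_backtrack hT (z := fun n => R (a + n)) (fun n => ray_adj R (a + n))
    (fun n h => by have := R.injective h; omega) n
  simpa using this

end

section

variable {V : Type*} {T : SimpleGraph V}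

/-! ### Ends -/

/-- Two rays have a common tail. In a tree this is equivalence of rays. -/
def TailEq (R S : rayGraph.Copy T) : Prop := ∃ a b, ∀ n, R (a + n) = S (b + n)

theorem TailEq.refl (R : rayGraph.Copy T) : TailEq R R := ⟨0, 0, fun _ => rfl⟩

theorem TailEq.symm {R S : rayGraph.Copy T} : TailEq R S → TailEq S R :=
  fun ⟨a, b, h⟩ => ⟨b, a, fun n => (h n).symm⟩

theorem TailEq.trans {R S U : rayGraph.Copy T} : TailEq R S → TailEq S U → TailEq R U := by
  rintro ⟨a, b, h⟩ ⟨c, d, h'⟩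
  refine ⟨a + c, d + b, fun n => ?_⟩
  rw [add_assoc, h, add_assoc, ← h', ← add_assoc, ← add_assoc, add_comm b c]

theorem TailEq.comp {R S : rayGraph.Copy T} (g : T.Copy T) :
    TailEq R S → TailEq (g.comp R) (g.comp S) :=
  fun ⟨a, b, h⟩ => ⟨a, b, fun n => by simp [SimpleGraph.Copy.comp_apply, h]⟩

/-- A ray whose vertices all lie on the ray `R` is a tail of `R`. -/
theorem exists_tail_of_range_subset (hT : T.IsTree) {Q R : rayGraph.Copy T}
    (h : Set.range Q ⊆ Set.range R) : ∃ a b, ∀ n, Q (a + n) = R (b + n) := by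
  obtain ⟨N, hN⟩ := exists_ray_away hT Q (R 0)
  refine ⟨N, T.dist (R 0) (Q N), fun n => ?_⟩
  obtain ⟨i, hi⟩ := h ⟨N + n, rfl⟩
  have h1 := hN n
  have h2 := ray_dist hT R 0 i
  rw [← hi] at h1 ⊢
  rw [zero_add] at h2
  rw [← h1, h2]

/-- Rays in a tree are equivalent iff they share a tail: if they do, then by uniqueness of geodesics
their intersection is the longest common tail. -/
theorem rayEquiv_iff {V : Type u} {T : SimpleGraph V} (hT : T.IsTree) {R S : Ray T} :
    RayEquiv R S ↔ TailEq R S := by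
  constructor
  · rintro ⟨Q, hQ⟩
    have h1 : TailEq Q R :=
      exists_tail_of_range_subset hT (hQ.trans_subset Set.inter_subset_left)
    have h2 : TailEq Q S :=
      exists_tail_of_range_subset hT (hQ.trans_subset Set.inter_subset_right)
    exact h1.symm.trans h2
  · intro h
    classical
    let i := Nat.find h
    obtain ⟨j, hj⟩ : ∃ j, ∀ n, R (i + n) = S (j + n) := Nat.find_spec h
    have hmin : ∀ i' < i, ¬ ∃ b, ∀ n, R (i' + n) = S (b + n) := fun i' h' => Nat.find_min h h'
    refine ⟨rayOfDist (fun n => R (i + n)) (fun n => ray_adj R (i + n)) (R i) 0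
      (fun n => by rw [ray_dist hT, zero_add]), ?_⟩
    ext v
    constructor
    · rintro ⟨n, rfl⟩
      exact ⟨⟨i + n, rfl⟩, ⟨j + n, (hj n).symm⟩⟩
    · rintro ⟨⟨i', rfl⟩, ⟨j', hj'⟩⟩
      rcases Nat.lt_or_ge i' i with hlt | hge
      · exfalso
        obtain ⟨c, hc⟩ := Nat.exists_eq_add_of_lt hlt
        have hd : T.dist (R i') (R i) = c + 1 := by
          rw [hc, add_assoc, ray_dist hT]
        have hji : R i = S j := hj 0
        rcases Nat.le_total j' j with hle | hle
        · obtain ⟨e, rfl⟩ := Nat.exists_eq_add_of_le hle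
          have hde : T.dist (S j') (S (j' + e)) = e := ray_dist hT S j' e
          rw [← hji, hj', hd] at hde
          subst hde
          -- Both rays follow the geodesic from `R i'` to `R i`.
          refine hmin i' hlt ⟨j', fun n => ?_⟩
          rcases Nat.le_total n (c + 1) with hn | hn
          · obtain ⟨k, hk⟩ := Nat.exists_eq_add_of_le hn
            apply ancestor_unique hT (r := R i') (w := R i)
            · rw [ray_dist hT, hd, show i = i' + n + k by omega, ray_dist hT]
              omega
            · rw [← hj', ray_dist hT, hj', hd, hji, hk, ← add_assoc, ray_dist hT]
            · rw [ray_dist hT, ← hj', ray_dist hT]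
          · obtain ⟨k, rfl⟩ := Nat.exists_eq_add_of_le hn
            have := hj k
            rw [show i = i' + (c + 1) by omega] at this
            rw [← add_assoc, this, add_assoc]
        · obtain ⟨e, rfl⟩ := Nat.exists_eq_add_of_le hle
          rw [← hj e] at hj'
          have := R.injective hj'
          omega
      · obtain ⟨n, rfl⟩ := Nat.exists_eq_add_of_le hge
        exact ⟨n, rfl⟩

/-- A vertex on the geodesic from `r` to `b` and at distance at least `D` from `b` is on the
geodesic from `r` to any vertex at distance at most `D` from `b`. -/
theorem Btw.of_near (hT : T.IsTree) {r w b b' : V} {D : ℕ} (h : Btw T r w b)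
    (hD : T.dist b b' ≤ D) (hw : D ≤ T.dist w b) : Btw T r w b' := by
  obtain ⟨k, hk⟩ : ∃ k, T.dist b b' = k := ⟨_, rfl⟩
  induction k generalizing b' D with
  | zero => rwa [← dist_eq_zero hT hk]
  | succ k ih =>
    obtain ⟨p, hp, hpd⟩ := exists_parent hT hk
    have hb : Btw T r w p := ih hpd.le (by omega) hpd
    have htri := dist_tri hT w p b
    rw [T.dist_comm (u := p)] at htri
    rcases dist_step hT r hp with h1 | h1
    · refine hb.of_child hT hp.symm h1 ?_
      rintro rfl
      rw [T.dist_comm] at hpd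
      omega
    · exact hb.child hT hp h1

/-- Rays that stay close to each other infinitely often have a common tail. -/
theorem tailEq_of_near (hT : T.IsTree) {R S : rayGraph.Copy T} {D : ℕ}
    (h : ∀ N, ∃ n m, N ≤ n ∧ N ≤ m ∧ T.dist (R n) (S m) ≤ D) : TailEq R S := by
  obtain ⟨N, hN⟩ := exists_ray_away hT S (R 0)
  refine ⟨T.dist (R 0) (S N), N, fun s => ?_⟩
  set i := T.dist (R 0) (S N) + s with hi
  obtain ⟨n, m, hn, hm, hnm⟩ := h (i + N + s + D)
  obtain ⟨k, rfl⟩ := Nat.exists_eq_add_of_le (show i ≤ n by omega)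
  obtain ⟨l, rfl⟩ := Nat.exists_eq_add_of_le (show N + s ≤ m by omega)
  have h0 : ∀ j, T.dist (R 0) (R j) = j := fun j => by simpa using ray_dist hT R 0 j
  have h1 : Btw T (R 0) (R i) (R (i + k)) := by
    unfold Btw
    rw [h0, ray_dist hT, h0]
  have h2 : Btw T (R 0) (R i) (S (N + s + l)) :=
    h1.of_near hT hnm (by rw [ray_dist hT]; omega)
  have h3 : Btw T (R 0) (S (N + s)) (S (N + s + l)) := by
    unfold Btw
    rw [ray_dist hT, hN, add_assoc N s l, hN]
    omega
  exact ancestor_unique hT h2 h3 (by rw [h0, hN])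

/-! ### Translations -/

/-- A self-embedding of a tree without fixed vertices and inversions translates a ray that starts at
a vertex of minimal displacement. -/
theorem exists_translated_ray (hT : T.IsTree) (h : T.Copy T) (hfix : ∀ x, h x ≠ x)
    (hinv : ∀ x, T.Adj x (h x) → h (h x) ≠ x) {x : V}
    (hmin : ∀ y, T.dist x (h x) ≤ T.dist y (h y)) :
    ∃ R : rayGraph.Copy T, R 0 = x ∧ ∀ n, h (R n) = R (n + T.dist x (h x)) := by
  set l := T.dist x (h x) with hl
  have hpos : 0 < l := Nat.pos_of_ne_zero fun h0 => hfix x (dist_eq_zero hT (hl ▸ h0)).symm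
  obtain ⟨p, hp⟩ := hT.connected.exists_walk_length_eq_dist x (h x)
  -- The geodesic from `x` to `h x`, continued by its images under the powers of `h`.
  let z : ℕ → V := fun n => h^[n / l] (p.getVert (n % l))
  have hz : ∀ n, z (n + l) = h (z n) := by
    intro n
    simp only [z]
    rw [Nat.add_div_right _ hpos, Nat.add_mod_right, Function.iterate_succ_apply']
  have hzp : ∀ n, n ≤ l → z n = p.getVert n := by
    intro n hn
    rcases hn.lt_or_eq with hn | rfl
    · simp [z, Nat.div_eq_of_lt hn, Nat.mod_eq_of_lt hn]
    · have h1 := hz 0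
      rw [zero_add] at h1
      rw [h1]
      simp only [z, Nat.zero_div, Nat.zero_mod, Function.iterate_zero, id]
      rw [p.getVert_zero, hl, ← hp, p.getVert_length]
  have hstart : z 0 = x := by rw [hzp 0 (Nat.zero_le _), p.getVert_zero]
  have hend : z l = h x := by rw [← zero_add l, hz, hstart]
  have hadj : ∀ n, T.Adj (z n) (z (n + 1)) := by
    intro n
    induction n using Nat.strong_induction_on with
    | _ n ih =>
      rcases Nat.lt_or_ge n l with hn | hn
      · rw [hzp n hn.le, hzp (n + 1) hn]
        exact p.adj_getVert_succ (by omega)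
      · obtain ⟨k, rfl⟩ := Nat.exists_eq_add_of_le' hn
        rw [hz, add_right_comm, hz]
        exact copy_map_adj h (ih k (by omega))
  have hle : ∀ a b, T.dist (z a) (z (a + b)) ≤ b := by
    intro a b
    induction b with
    | zero => simp
    | succ b ih =>
      have h1 := dist_tri hT (z a) (z (a + b)) (z (a + b + 1))
      rw [dist_of_adj (hadj _)] at h1
      rw [← add_assoc]
      omega
  have hback : ∀ n, z n ≠ z (n + 2) := by
    intro n
    induction n using Nat.strong_induction_on with
    | _ n ih =>
      rcases Nat.lt_or_ge n l with hn | hn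
      · intro he
        rcases Nat.lt_or_ge (n + 1) l with hn' | hn'
        · have h1 := hle 0 n
          have h2 := hle (n + 2) (l - (n + 2))
          have h3 := dist_tri hT (z 0) (z n) (z l)
          rw [show n + 2 + (l - (n + 2)) = l by omega, ← he] at h2
          rw [zero_add] at h1
          rw [hstart, hend] at h3
          rw [hstart] at h1
          rw [hend] at h2
          omega
        · have hnl : n + 1 = l := by omega
          have h1 : z (n + 2) = h (z 1) := by rw [← hz, ← hnl]; congr 1; omega
          rw [h1] at he
          rcases Nat.eq_zero_or_pos n with rfl | hn0
          · have h2 : z 1 = h x := by rw [← hend, ← hnl]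
            rw [h2, hstart] at he
            refine hinv x ?_ he.symm
            rw [← h2, ← hstart]
            exact hadj 0
          · have h2 := hmin (z 1)
            have h3 := hle 1 (n - 1)
            rw [show 1 + (n - 1) = n by omega, he] at h3
            omega
      · obtain ⟨k, rfl⟩ := Nat.exists_eq_add_of_le' hn
        rw [hz, add_right_comm, hz]
        exact fun he => ih k (by omega) (h.injective he)
  refine ⟨rayOfDist z hadj (z 0) 0 fun n => ?_, hstart, fun n => (hz n).symm⟩
  rw [dist_of_no_backtrack hT hadj hback, zero_add]

/-- In a locally finite tree a non-surjective embedding preserves no finite set. -/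
theorem no_finite_invariant [T.LocallyFinite] (hT : T.IsTree) (f : T.Copy T)
    (hf : ¬ Function.Surjective f) {F : Set V} (hF : F.Finite) (hne : F.Nonempty)
    (hfF : f '' F = F) : False := by
  apply hf
  intro v
  obtain ⟨u, hu⟩ := hne
  -- The ball around `F` that contains `v` is finite and mapped into itself.
  let A : Set V := ⋃ w ∈ F, {y | T.dist w y ≤ T.dist u v}
  have hA : A.Finite := hF.biUnion fun w _ => finite_ball hT w _
  have hfA : Set.MapsTo f A A := by
    intro y hy
    obtain ⟨w, hw, hwy⟩ := Set.mem_iUnion₂.1 hy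
    refine Set.mem_iUnion₂.2 ⟨f w, hfF ▸ Set.mem_image_of_mem f hw, ?_⟩
    change T.dist (f w) (f y) ≤ _
    rw [copy_dist hT hT]
    exact hwy
  obtain ⟨y, -, hy⟩ := ((hA.injOn_iff_bijOn_of_mapsTo hfA).1 f.injective.injOn).surjOn
    (Set.mem_iUnion₂.2 ⟨u, hu, show T.dist u v ≤ T.dist u v from le_rfl⟩ : v ∈ A)
  exact ⟨y, hy⟩

theorem mem_endClass_iff {V : Type u} {T : SimpleGraph V} (hT : T.IsTree) {R S : Ray T} :
    S ∈ {S | RayEquiv R S} ↔ TailEq R S := rayEquiv_iff hT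

/-- If the ranges of the iterates of an embedding without finite invariant set have a common
vertex, then the embedding acts on their intersection as a translation, and the two ends of its
axis are the only fixed ends. -/
theorem fixedEnds_encard {V : Type u} {T : SimpleGraph V} (hT : T.IsTree) (f : T.Copy T)
    (hfin : ∀ F : Set V, F.Finite → F.Nonempty → f '' F ≠ F)
    {q : V} (hq : ∀ n, q ∈ Set.range f^[n]) : (fixedEnds f).encard = 2 := by
  set Q : Set V := {v | ∀ n, v ∈ Set.range f^[n]} with hQ
  have hfQ : ∀ v ∈ Q, f v ∈ Q := by
    rintro v hv (_ | n)
    · exact ⟨f v, rfl⟩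
    · obtain ⟨u, hu⟩ := hv n
      exact ⟨u, by rw [Function.iterate_succ_apply', hu]⟩
  have hQtree : (T.induce Q).IsTree := by
    refine induce_isTree hT (r := q) hq fun p w hpw hd hw n => ?_
    obtain ⟨q', rfl⟩ := hq n
    obtain ⟨w', rfl⟩ := hw n
    rw [dist_iterate hT] at hd
    obtain ⟨p', hp', hpd⟩ := exists_parent hT hd
    obtain ⟨g, hg⟩ := exists_iterate_copy f n
    refine ⟨p', parent_unique hT (r := f^[n] q') (w := f^[n] w') ?_ hpw ?_ ?_⟩
    · rw [← hg]; exact copy_map_adj g hp'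
    · rw [dist_iterate hT, dist_iterate hT, hpd, hd]
    · rw [dist_iterate hT, hd]
  let fQ : (T.induce Q).Copy (T.induce Q) :=
    ⟨⟨fun v => ⟨f v, hfQ v v.2⟩, fun {a b} hab => copy_map_adj f hab⟩, fun a b hab =>
      Subtype.ext (f.injective (congrArg Subtype.val hab))⟩
  have hsurj : Function.Surjective fQ := by
    rintro ⟨v, hv⟩
    obtain ⟨u, hu⟩ := hv 1
    refine ⟨⟨u, fun n => ?_⟩, Subtype.ext hu⟩
    obtain ⟨w, hw⟩ := hv (n + 1)
    refine ⟨w, f.injective ?_⟩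
    exact (Function.iterate_succ_apply' f n w).symm.trans (hw.trans hu.symm)
  obtain ⟨e, he⟩ := iso_of_surjective hQtree hQtree fQ hsurj
  have hef : ∀ v : Q, (e v : V) = f v := fun v => congrArg Subtype.val (he v)
  have hfix : ∀ v : Q, e v ≠ v := by
    intro v hv
    have h1 : f v = v := by rw [← hef, hv]
    exact hfin {v.1} (Set.finite_singleton _) (Set.singleton_nonempty _) (by simp [h1])
  have hinv : ∀ v : Q, e (e v) ≠ v := by
    intro v hv
    have h1 : f (f v) = v := by rw [← hef, ← hef, hv]
    refine hfin {v.1, f v} (Set.toFinite _) ⟨_, Or.inl rfl⟩ ?_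
    rw [Set.image_pair, h1, Set.pair_comm]
  obtain ⟨x, -, hx⟩ := WellFounded.has_min
    (measure fun v : Q => (T.induce Q).dist v (e v)).wf Set.univ ⟨⟨q, hq⟩, trivial⟩
  have hmin : ∀ y, (T.induce Q).dist x (e x) ≤ (T.induce Q).dist y (e y) :=
    fun y => not_lt.1 (hx y trivial)
  set l := (T.induce Q).dist x (e x) with hl
  have hpos : 0 < l :=
    Nat.pos_of_ne_zero fun h0 => hfix x (dist_eq_zero hQtree (hl ▸ h0)).symm
  have hdsymm : ∀ y, (T.induce Q).dist y (e.symm y) =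
      (T.induce Q).dist (e.symm y) (e (e.symm y)) := by
    intro y
    rw [e.apply_symm_apply, SimpleGraph.dist_comm]
  have hlx : (T.induce Q).dist x (e.symm x) = l := by
    rw [hl, ← copy_dist hQtree hQtree e.toCopy x (e.symm x)]
    change (T.induce Q).dist (e x) (e (e.symm x)) = _
    rw [e.apply_symm_apply, SimpleGraph.dist_comm]
  obtain ⟨P, -, hP⟩ := exists_translated_ray hQtree e.toCopy hfix (fun v _ => hinv v) hmin
  obtain ⟨M, -, hM⟩ := exists_translated_ray hQtree e.symm.toCopy (x := x)
    (fun v hv => hfix (e.symm v) (by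
      rw [e.apply_symm_apply]; exact hv.symm))
    (fun v _ hv => hinv v (by
      have h1 : e.symm (e.symm v) = v := hv
      conv_lhs => rw [← h1]
      rw [e.apply_symm_apply, e.apply_symm_apply]))
    (fun y => by
      change (T.induce Q).dist x (e.symm x) ≤ (T.induce Q).dist y (e.symm y)
      rw [hlx, hdsymm]
      exact hmin _)
  let P' : Ray T := (SimpleGraph.Copy.induce T Q).comp P
  let M' : Ray T := (SimpleGraph.Copy.induce T Q).comp M
  have hP' : ∀ n, f (P' n) = P' (n + l) := fun n => by
    have h1 : e (P n) = P (n + l) := hP n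
    change f (P n : V) = (P (n + l) : V)
    rw [← h1, hef]
  have hM' : ∀ n, f (M' (n + l)) = M' n := fun n => by
    have h1 : e.symm (M n) = M (n + l) := by
      have h2 := hM n
      change e.symm (M n) = M (n + (T.induce Q).dist x (e.symm x)) at h2
      rwa [hlx] at h2
    change f (M (n + l) : V) = (M n : V)
    rw [← h1, ← hef, e.apply_symm_apply]
  -- `f` moves `P'` forwards and `M'` backwards.
  have hPM : ¬ TailEq P' M' := by
    rintro ⟨a, b, h⟩
    have h1 := hP' (a + l)
    rw [h l, hM' b, add_assoc, h (l + l)] at h1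
    have := M'.injective h1
    omega
  have hiterP : ∀ j, f^[j] (P' 0) = P' (j * l) := by
    intro j
    induction j with
    | zero => simp
    | succ j ih => rw [Function.iterate_succ_apply', ih, hP', Nat.succ_mul]
  have hiterM : ∀ j, f^[j] (M' (j * l)) = M' 0 := by
    intro j
    induction j with
    | zero => simp
    | succ j ih => rw [Function.iterate_succ_apply, Nat.succ_mul, hM', ih]
  have hset : fixedEnds f = {{S | RayEquiv P' S}, {S | RayEquiv M' S}} := by
    have hcl : ∀ {R S : Ray T}, TailEq R S → {U | RayEquiv R U} = {U | RayEquiv S U} := by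
      intro R S hRS
      ext U
      rw [mem_endClass_iff hT, mem_endClass_iff hT]
      exact ⟨hRS.symm.trans, hRS.trans⟩
    ext η
    constructor
    · rintro ⟨⟨S, rfl⟩, hS⟩
      have hSS := hS S ((mem_endClass_iff hT).2 (TailEq.refl S))
      obtain ⟨a, b, h⟩ := (mem_endClass_iff hT).1 hSS
      replace h : ∀ n, S (a + n) = f (S (b + n)) := h
      -- `f` translates a tail of `S` backwards, fixes it, or translates it forwards. In the outer
      -- cases the tail is close to `M'` or `P'` infinitely often; the middle one is excluded.
      rcases lt_trichotomy a b with hab | rfl | hab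
      · right
        obtain ⟨c, rfl⟩ := Nat.exists_eq_add_of_lt hab
        have hiter : ∀ j, f^[j] (S (a + j * (c + 1))) = S a := by
          intro j
          induction j with
          | zero => simp
          | succ j ih =>
            rw [Function.iterate_succ_apply, Nat.succ_mul,
              show a + (j * (c + 1) + (c + 1)) = a + c + 1 + j * (c + 1) by ring, ← h, ih]
        refine hcl (tailEq_of_near hT (D := T.dist (S a) (M' 0)) fun N => ?_)
        refine ⟨a + N * (c + 1), N * l, by nlinarith, by nlinarith, ?_⟩
        rw [← dist_iterate hT f N, hiter, hiterM]
      · refine absurd (h 0).symm fun h0 => ?_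
        exact hfin {S (a + 0)} (Set.finite_singleton _) (Set.singleton_nonempty _)
          (by rw [Set.image_singleton, h0])
      · left
        obtain ⟨c, rfl⟩ := Nat.exists_eq_add_of_lt hab
        have hiter : ∀ j, f^[j] (S b) = S (b + j * (c + 1)) := by
          intro j
          induction j with
          | zero => simp
          | succ j ih =>
            rw [Function.iterate_succ_apply', ih, ← h, Nat.succ_mul]
            congr 1
            ring
        refine hcl (tailEq_of_near hT (D := T.dist (S b) (P' 0)) fun N => ?_)
        refine ⟨b + N * (c + 1), N * l, by nlinarith, by nlinarith, ?_⟩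
        rw [← hiter, ← hiterP, dist_iterate hT]
    · have hmem : ∀ R : Ray T, TailEq R (f.comp R) → {S | RayEquiv R S} ∈ fixedEnds f := by
        intro R hR
        refine ⟨⟨R, rfl⟩, fun S hS => ?_⟩
        rw [mem_endClass_iff hT] at hS ⊢
        exact hR.trans (hS.comp f)
      rintro (rfl | rfl)
      · refine hmem P' ⟨l, 0, fun n => ?_⟩
        change P' (l + n) = f (P' (0 + n))
        rw [hP', zero_add, add_comm]
      · refine hmem M' ⟨0, l, fun n => ?_⟩
        change M' (0 + n) = f (M' (l + n))
        rw [add_comm l, hM', zero_add]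
  rw [hset, Set.encard_pair]
  intro h
  have h1 : M' ∈ {S | RayEquiv P' S} := h ▸ (mem_endClass_iff hT).2 (TailEq.refl M')
  exact hPM ((mem_endClass_iff hT).1 h1)

/-- The images of the iterates of a non-surjective, non-hyperbolic embedding of a locally finite
tree have empty intersection. -/
theorem exists_notMem_range_iterate {V : Type u} {T : SimpleGraph V} [T.LocallyFinite]
    (hT : T.IsTree) (f : Emb T) (hf : ¬ Function.Surjective f) (hyp : ¬ IsHyperbolic f) (q : V) :
    ∃ n, q ∉ Set.range f^[n] := by
  by_contra! h
  refine hyp ⟨?_, fixedEnds_encard hT f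
    (fun F hF hne hFF => no_finite_invariant hT f hf hF hne hFF) h⟩
  rintro ⟨F, hF, hconn, hFF⟩
  obtain ⟨v⟩ := hconn.nonempty
  exact no_finite_invariant hT f hf hF ⟨v.1, v.2⟩ hFF

end

section

variable {V : Type u} {T : SimpleGraph V}

/-! ### The attracting ray of an embedding -/

theorem range_iterate_antitone (f : V → V) {a b : ℕ} (h : a ≤ b) :
    Set.range f^[b] ⊆ Set.range f^[a] := by
  obtain ⟨c, rfl⟩ := Nat.exists_eq_add_of_le h
  rintro _ ⟨v, rfl⟩
  exact ⟨f^[c] v, by rw [Function.iterate_add_apply]⟩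

/-- If the images of the iterates of `f` have empty intersection, they converge to an end: there
is a ray such that every subtree hanging off it contains the image of some iterate. -/
theorem exists_attracting_ray [T.LocallyFinite] (hT : T.IsTree) (f : Emb T)
    (hf : ∀ q, ∃ n, q ∉ Set.range f^[n]) :
    ∃ R : Ray T, ∀ n, ∃ a, ∀ w ∈ Set.range f^[a], Btw T (R 0) (R n) w := by
  obtain ⟨r⟩ := hT.connected.nonempty
  -- A high iterate avoids a given ball around `r`, so its image, being connected, lies beyond a
  -- single vertex `z n` at distance `n` from `r`.
  have hout : ∀ n, ∃ a, ∀ w ∈ Set.range f^[a], n ≤ T.dist r w := by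
    intro n
    choose m hm using hf
    obtain ⟨a, ha⟩ := ((finite_ball hT r n).image m).bddAbove
    refine ⟨a, fun w hw => ?_⟩
    by_contra! hlt
    exact hm w (range_iterate_antitone f (ha ⟨w, hlt.le, rfl⟩) hw)
  choose a ha using hout
  choose z hz hzb using fun n => exists_ancestor hT r (f^[a n] r) (ha n _ ⟨r, rfl⟩)
  have hanc : ∀ n, ∀ w ∈ Set.range f^[a n], Btw T r (z n) w := by
    rintro n _ ⟨v, rfl⟩
    obtain ⟨k, hk⟩ : ∃ k, T.dist r v = k := ⟨_, rfl⟩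
    induction k generalizing v with
    | zero =>
      rw [← dist_eq_zero hT hk]
      unfold Btw
      rw [hz, hzb]
    | succ k ih =>
      obtain ⟨p, hp, hpd⟩ := exists_parent hT hk
      have h1 := ih p hpd
      obtain ⟨g, hg⟩ := exists_iterate_copy f (a n)
      have hadj : T.Adj (f^[a n] p) (f^[a n] v) := hg ▸ copy_map_adj g hp
      rcases dist_step hT r hadj with h2 | h2
      · refine h1.of_child hT hadj.symm h2 fun h3 => ?_
        have h4 := ha n _ ⟨v, rfl⟩
        rw [← h3, hz] at h2
        omega
      · exact h1.child hT hadj h2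
  have hadj : ∀ n, T.Adj (z n) (z (n + 1)) := by
    intro n
    have h1 := hanc n (f^[max (a n) (a (n + 1))] r)
      (range_iterate_antitone f (le_max_left _ _) ⟨r, rfl⟩)
    have h2 := hanc (n + 1) (f^[max (a n) (a (n + 1))] r)
      (range_iterate_antitone f (le_max_right _ _) ⟨r, rfl⟩)
    have h3 := h1.comparable hT h2 (by rw [hz, hz]; omega)
    unfold Btw at h3
    rw [hz, hz] at h3
    exact adj_of_dist (by omega)
  refine ⟨rayOfDist z hadj r 0 fun n => by rw [hz, zero_add], fun n => ⟨a n, ?_⟩⟩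
  change ∀ w ∈ Set.range f^[a n], Btw T (z 0) (z n) w
  rw [← dist_eq_zero hT (hz 0)]
  exact hanc n

theorem ray_dist_zero (hT : T.IsTree) (R : Ray T) (n : ℕ) : T.dist (R 0) (R n) = n := by
  simpa using ray_dist hT R 0 n

theorem ray_btw (hT : T.IsTree) (R : Ray T) {m n : ℕ} (h : m ≤ n) : Btw T (R 0) (R m) (R n) := by
  obtain ⟨k, rfl⟩ := Nat.exists_eq_add_of_le h
  unfold Btw
  rw [ray_dist_zero hT, ray_dist hT, ray_dist_zero hT]

/-- Ancestors of vertices of a ray lie on the ray. -/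
theorem mem_range_of_btw (hT : T.IsTree) (R : Ray T) {u : V} {n : ℕ} (h : Btw T (R 0) u (R n)) :
    u = R (T.dist (R 0) u) := by
  have hle : T.dist (R 0) u ≤ n := by
    have h1 := ray_dist_zero hT R n
    unfold Btw at h
    omega
  exact ancestor_unique hT h (ray_btw hT R hle) (by rw [ray_dist_zero hT])

/-! ### Rays -/

/-- An infinite tree with at most one vertex at each distance from a given vertex is a ray. -/
theorem isRay_of_level [Infinite V] (hT : T.IsTree) (r : V)
    (h : ∀ u v, T.dist r u = T.dist r v → u = v) : IsRay T := by
  have hsurj : Function.Surjective (T.dist r) := by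
    intro n
    obtain ⟨w, hw⟩ : ∃ w, n ≤ T.dist r w := by
      by_contra! hlt
      have : Set.Finite (Set.univ : Set V) :=
        Set.Finite.of_injOn (f := T.dist r) (t := Set.Iio n) (fun v _ => hlt v)
          (fun u _ v _ => h u v) (Set.finite_Iio n)
      exact Set.infinite_univ this
    obtain ⟨u, hu, -⟩ := exists_ancestor hT r w hw
    exact ⟨u, hu⟩
  refine ⟨⟨Equiv.ofBijective (T.dist r) ⟨fun u v => h u v, hsurj⟩, ?_⟩⟩
  intro a b
  change rayGraph.Adj (T.dist r a) (T.dist r b) ↔ _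
  have key : ∀ {a b : V}, T.dist r a + 1 = T.dist r b → T.Adj a b := by
    intro a b hab
    obtain ⟨p, hp, hpd⟩ := exists_parent hT hab.symm
    rwa [h a p hpd.symm]
  rw [adj_rayGraph]
  refine ⟨fun hab => hab.elim key fun hba => (key hba).symm, fun hab => ?_⟩
  rcases dist_step hT r hab with h1 | h1
  · exact Or.inr h1.symm
  · exact Or.inl h1.symm

/-- An infinite tree that embeds in a ray is a ray: seen from the vertex with the least image, the
embedding is monotone. -/
theorem isRay_of_copy [Infinite V] (hT : T.IsTree) (g : T.Copy rayGraph) : IsRay T := by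
  obtain ⟨v₀⟩ := hT.connected.nonempty
  obtain ⟨r, -, hr⟩ := WellFounded.has_min (measure g).wf Set.univ ⟨v₀, trivial⟩
  have hmin : ∀ v, g r ≤ g v := fun v => not_lt.1 (hr v trivial)
  refine isRay_of_level hT r fun u v huv => ?_
  have key : ∀ k w, T.dist r w = k → g w = g r + k := by
    intro k
    induction k using Nat.strong_induction_on with
    | _ k ih =>
      intro w hw
      rcases k with _ | _ | k
      · rw [dist_eq_zero hT hw]; rfl
      · have h1 := hmin w
        rcases adj_rayGraph.1 (copy_map_adj g (adj_of_dist hw)) with h2 | h2 <;> omega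
      · obtain ⟨p, hp, hpd⟩ := exists_parent hT hw
        obtain ⟨q, hq, hqd⟩ := exists_parent hT hpd
        have h1 := ih _ (by omega) p hpd
        have h2 := ih _ (by omega) q hqd
        have h3 : g q ≠ g w := fun he => by
          have := g.injective he
          subst this
          omega
        rcases adj_rayGraph.1 (copy_map_adj g hp) with h4 | h4 <;> omega
  exact g.injective ((key _ u rfl).trans (huv ▸ (key _ v rfl).symm))

/-- In an infinite tree that is not a ray, infinitely many branches leave the attracting ray of an
embedding: otherwise an iterate maps the tree into that ray. -/
theorem exists_branch [Infinite V] (hT : T.IsTree) (hray : ¬ IsRay T) (f : Emb T) (R : Ray T)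
    (hR : ∀ n, ∃ a, ∀ w ∈ Set.range f^[a], Btw T (R 0) (R n) w) (M : ℕ) :
    ∃ k, M ≤ k ∧ ∃ w, T.Adj (R (k + 1)) w ∧ w ≠ R k ∧ w ≠ R (k + 2) := by
  by_contra! h
  have key : ∀ l w, T.dist (R 0) w = l → Btw T (R 0) (R (M + 1)) w → w = R l := by
    intro l
    induction l with
    | zero =>
      intro w hw _
      exact (dist_eq_zero hT hw).symm
    | succ l ih =>
      intro w hw hb
      by_cases hne : R (M + 1) = w
      · rw [← hne, ray_dist_zero hT] at hw
        rw [← hne, hw]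
      · obtain ⟨p, hp, hpd⟩ := exists_parent hT hw
        have hbp := hb.of_child hT hp (by omega) hne
        obtain rfl := ih p hpd hbp
        obtain ⟨c, rfl⟩ : ∃ c, l = c + 1 := by
          refine Nat.exists_eq_add_one.2 ?_
          unfold Btw at hbp
          rw [ray_dist_zero hT, ray_dist_zero hT] at hbp
          omega
        refine h c ?_ w hp ?_
        · unfold Btw at hbp
          rw [ray_dist_zero hT, ray_dist_zero hT] at hbp
          omega
        · rintro rfl
          rw [ray_dist_zero hT] at hw
          omega
  obtain ⟨a, ha⟩ := hR (M + 1)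
  obtain ⟨g, hg⟩ := exists_iterate_copy f a
  have hgR : ∀ v, g v = R (T.dist (R 0) (g v)) := fun v =>
    key _ _ rfl (ha _ ⟨v, by rw [hg]⟩)
  refine hray (isRay_of_copy hT ⟨⟨fun v => T.dist (R 0) (g v), fun {u v} huv => ?_⟩, ?_⟩)
  · rw [adj_rayGraph]
    rcases dist_step hT (R 0) (copy_map_adj g huv) with h1 | h1
    · exact Or.inr h1.symm
    · exact Or.inl h1.symm
  · intro u v huv
    refine g.injective ?_
    change g u = g v
    rw [hgR u, hgR v]
    exact congrArg R huv

/-! ### Siblings -/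

/-- A subtree of `T` containing the image of an embedding of `T`, as a sibling of `T`. -/
def siblingOfSubtree (X : Set V) (hX : (T.induce X).IsTree) (g : Emb T)
    (hg : ∀ w ∈ Set.range g, w ∈ X) : Sibling T where
  Vert := X
  graph := T.induce X
  isTree := hX
  equimorphic := ⟨⟨⟨⟨fun v => ⟨g v, hg _ ⟨v, rfl⟩⟩, fun h => copy_map_adj g h⟩,
    fun _ _ h => g.injective (congrArg Subtype.val h)⟩⟩, ⟨SimpleGraph.Copy.induce T X⟩⟩

theorem sib_eq_one (hT : T.IsTree)
    (h : ∀ A B : Sibling T, Nonempty (A.graph ≃g B.graph)) : Sib T = 1 := by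
  unfold Sib
  let A : Sibling T := ⟨V, T, hT, ⟨.id T⟩, ⟨.id T⟩⟩
  have : Unique (Quotient (siblingSetoid T)) :=
    { default := Quotient.mk _ A
      uniq := fun q => Quotient.inductionOn q fun B => Quotient.sound (h B A) }
  exact ENat.card_eq_one_iff_unique.2 ⟨this⟩

theorem sib_eq_top_of_injective {ι : Type*} [Infinite ι] (X : ι → Sibling T)
    (h : ∀ i j, Nonempty ((X i).graph ≃g (X j).graph) → i = j) : Sib T = ⊤ := by
  unfold Sib
  have : Infinite (Quotient (siblingSetoid T)) :=
    Infinite.of_injective (fun i => (Quotient.mk _ (X i) : Quotient (siblingSetoid T)))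
      fun i j hij => h i j (Quotient.exact hij)
  exact ENat.card_eq_top_of_infinite

/-- A countable tree has infinitely many siblings as soon as it has an uncountable family of
siblings, each with two marked vertices, that are pairwise non-isomorphic as marked trees: each
tree has only countably many markings. -/
theorem sib_eq_top_of_uncountable [Countable V] {ι : Type*} [Uncountable ι] (X : ι → Sibling T)
    (a b : ∀ i, (X i).Vert)
    (h : ∀ i j, ∀ φ : (X i).graph ≃g (X j).graph, φ (a i) = a j → φ (b i) = b j → i = j) :
    Sib T = ⊤ := by
  by_contra htop
  have hfin : Finite (Quotient (siblingSetoid T)) := by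
    by_contra hinf
    rw [not_finite_iff_infinite] at hinf
    exact htop ENat.card_eq_top_of_infinite
  have hcount : (Set.univ : Set ι).Countable := by
    have hU : (Set.univ : Set ι) =
        ⋃ q : Quotient (siblingSetoid T), {i | Quotient.mk _ (X i) = q} := by
      ext i; simp
    rw [hU]
    refine Set.countable_iUnion fun q => ?_
    rcases Set.eq_empty_or_nonempty {i | Quotient.mk (siblingSetoid T) (X i) = q} with he | ⟨j, hj⟩
    · rw [he]; exact Set.countable_empty
    · have hiso : ∀ i : {i | Quotient.mk (siblingSetoid T) (X i) = q},
          Nonempty ((X i).graph ≃g (X j).graph) := fun i =>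
        Quotient.exact (i.2.trans hj.symm)
      let φ := fun i => (hiso i).some
      obtain ⟨g⟩ := (X j).equimorphic.2
      have hinj : Function.Injective fun i => (g (φ i (a i)), g (φ i (b i))) := by
        intro i i' hii
        have h1 := g.injective (congrArg Prod.fst hii)
        have h2 := g.injective (congrArg Prod.snd hii)
        refine Subtype.ext (h i i' ((φ i).trans (φ i').symm) ?_ ?_)
        · exact (φ i').symm_apply_eq.2 h1
        · exact (φ i').symm_apply_eq.2 h2
      exact Set.countable_coe_iff.1 hinj.countable
  exact not_countable (Set.countable_univ_iff.1 hcount)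

/-- If all embeddings of `T` are surjective, so are all embeddings of siblings into `T`. -/
theorem sib_eq_one_of_surjective (hT : T.IsTree) (h : ∀ f : Emb T, Function.Surjective f) :
    Sib T = 1 := by
  have key : ∀ A : Sibling T, Nonempty (A.graph ≃g T) := by
    intro A
    obtain ⟨⟨p⟩, ⟨q⟩⟩ := A.equimorphic
    have hq : Function.Surjective q := by
      have := h (q.comp p)
      rw [SimpleGraph.Copy.coe_comp] at this
      exact this.of_comp
    obtain ⟨e, -⟩ := iso_of_surjective A.isTree hT q hq
    exact ⟨e⟩
  refine sib_eq_one hT fun A B => ?_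
  obtain ⟨e⟩ := key A
  obtain ⟨e'⟩ := key B
  exact ⟨e.trans e'.symm⟩

theorem sib_eq_one_of_isRay (hT : T.IsTree) (h : IsRay T) : Sib T = 1 := by
  obtain ⟨e⟩ := h
  have hV : Infinite V := Infinite.of_injective _ e.symm.injective
  have key : ∀ A : Sibling T, IsRay A.graph := by
    intro A
    obtain ⟨⟨p⟩, ⟨q⟩⟩ := A.equimorphic
    have : Infinite A.Vert := Infinite.of_injective p p.injective
    exact isRay_of_copy A.isTree (e.toCopy.comp q)
  refine sib_eq_one hT fun A B => ?_
  obtain ⟨e₁⟩ := key A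
  obtain ⟨e₂⟩ := key B
  exact ⟨e₁.trans e₂.symm⟩

end

section

variable {V : Type u} {T : SimpleGraph V}

/-! ### Infinitely many branches along a second end -/

/-- If some ray `z` that leaves `R` has infinitely many branch vertices, then the part of `T` beyond
`z 1`, which an iterate of `f` avoids, can be replaced by combs with arbitrary sets of teeth. -/
theorem sib_eq_top_of_comb [T.LocallyFinite] (hT : T.IsTree) (f : Emb T) (R : Ray T)
    (hR : ∀ n, ∃ a, ∀ w ∈ Set.range f^[a], Btw T (R 0) (R n) w) (z : ℕ → V) (d : ℕ)
    (hadj : ∀ s, T.Adj (z s) (z (s + 1))) (hd : ∀ s, T.dist (R 0) (z s) = d + s)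
    (hz : z 1 ∉ Set.range R)
    (hbr : {s | ∃ w, T.Adj (z (s + 1)) w ∧ w ≠ z s ∧ w ≠ z (s + 2)}.Infinite) : Sib T = ⊤ := by
  set r := R 0 with hr
  set J := {s | ∃ w, T.Adj (z (s + 1)) w ∧ w ≠ z s ∧ w ≠ z (s + 2)} \ {0} with hJ
  have hJinf : J.Infinite := hbr.sdiff (Set.finite_singleton 0)
  choose t htadj ht1 ht2 using fun s : J => s.2.1
  have hdt : ∀ s : J, T.dist r (t s) = T.dist r (z (s + 1)) + 1 := fun s =>
    dist_no_turn hT (hadj s) (htadj s) (ht1 s).symm (by rw [hd, hd]; rfl)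
  have hbz : ∀ s, Btw T r (z 1) (z (s + 1)) := by
    intro s
    induction s with
    | zero => exact Btw.self _ _
    | succ s ih => exact ih.child hT (hadj _) (by rw [hd, hd]; rfl)
  have hpar : ∀ {s v}, T.Adj v (z (s + 1)) → T.dist r v + 1 = T.dist r (z (s + 1)) → v = z s :=
    fun {s v} h1 h2 => parent_unique hT h1 (hadj s) h2 (by rw [hd, hd]; rfl)
  -- Everything beyond `z 1` is cut off except the ray `z` and the teeth `t s` with `s ∈ B`.
  let X : Set J → Set V := fun B => {v | Btw T r (z 1) v → v ∈ Set.range z ∨ v ∈ t '' B}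
  have hzX : ∀ B s, z s ∈ X B := fun B s _ => Or.inl ⟨s, rfl⟩
  have htX : ∀ (B : Set J) s, s ∈ B → t s ∈ X B := fun B s hs _ => Or.inr ⟨s, hs, rfl⟩
  have htree : ∀ B, (T.induce (X B)).IsTree := by
    intro B
    refine induce_isTree hT (r := r) (fun h => ?_) fun p w hpw hdw hw hbp => ?_
    · exfalso
      unfold Btw at h
      rw [hd, SimpleGraph.dist_self] at h
      omega
    · rcases hw (hbp.child hT hpw hdw) with ⟨s, rfl⟩ | ⟨s, hs, rfl⟩
      · rcases s with _ | s
        · unfold Btw at hbp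
          rw [hd] at hbp hdw
          omega
        · exact Or.inl ⟨s, (hpar hpw hdw.symm).symm⟩
      · exact Or.inl ⟨s + 1, parent_unique hT (htadj s) hpw (hdt s).symm hdw.symm⟩
  obtain ⟨a, ha⟩ := hR (d + 1)
  obtain ⟨g, hg⟩ := exists_iterate_copy f a
  have hgX : ∀ B, ∀ w ∈ Set.range g, w ∈ X B := by
    intro B w hw hb
    rw [hg] at hw
    have h1 := hb.comparable hT (ha w hw) (by rw [hd, ray_dist_zero hT])
    exact absurd ⟨_, (mem_range_of_btw hT R h1).symm⟩ hz
  -- The neighbours in the pruned tree of the vertices of `z` and of the teeth.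
  have hnz : ∀ {B s v}, v ∈ X B → T.Adj (z (s + 1)) v →
      v = z s ∨ v = z (s + 2) ∨ ∃ i ∈ B, (i : ℕ) = s ∧ v = t i := by
    intro B s v hv hsv
    rcases dist_step hT r hsv with h1 | h1
    · exact Or.inl (hpar hsv.symm h1.symm)
    · refine Or.inr ?_
      rcases hv ((hbz s).child hT hsv h1) with ⟨s', rfl⟩ | ⟨i, hi, rfl⟩
      · rw [hd, hd] at h1
        obtain rfl : s' = s + 2 := by omega
        exact Or.inl rfl
      · rw [hdt, hd, hd] at h1
        exact Or.inr ⟨i, hi, by omega, rfl⟩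
  have hnt : ∀ {B i v}, v ∈ X B → T.Adj (t i) v → v = z (i + 1) := by
    intro B i v hv hiv
    rcases dist_step hT r hiv with h1 | h1
    · exact parent_unique hT hiv.symm (htadj i) h1.symm (hdt i).symm
    · exfalso
      rcases hv (((hbz i).child hT (htadj i) (hdt i)).child hT hiv h1) with ⟨s', rfl⟩ | ⟨j, hj, rfl⟩
      · have h2 := h1
        rw [hdt, hd, hd] at h2
        obtain rfl : s' = i + 2 + 1 := by omega
        exact ht2 i (hpar hiv h1.symm)
      · have h2 := h1
        rw [hdt, hdt, hd, hd] at h2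
        have h3 : (j : ℕ) = i + 1 := by omega
        have h4 := parent_unique hT hiv (htadj j) h1.symm (hdt j).symm
        rw [h3] at h4
        exact ht2 i h4
  have hinj : ∀ {s s'}, z s = z s' → s = s' := by
    intro s s' h
    have h1 := hd s
    rw [h, hd] at h1
    omega
  have key : ∀ (B B' : Set J) (φ : T.induce (X B) ≃g T.induce (X B')),
      φ ⟨z 0, hzX B 0⟩ = ⟨z 0, hzX B' 0⟩ → φ ⟨z 1, hzX B 1⟩ = ⟨z 1, hzX B' 1⟩ → B ⊆ B' := by
    intro B B' φ h0 h1
    have hφ : ∀ u v : X B, T.Adj u v → T.Adj (φ u) (φ v) := fun u v huv => φ.map_adj_iff.2 huv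
    have hφi : ∀ u v : X B, (φ u : V) = φ v → (u : V) = v := fun u v huv =>
      congrArg Subtype.val (φ.injective (Subtype.ext huv))
    have hfix : ∀ s, (φ ⟨z s, hzX B s⟩ : V) = z s ∧ (φ ⟨z (s + 1), hzX B _⟩ : V) = z (s + 1) := by
      intro s
      induction s with
      | zero => exact ⟨congrArg Subtype.val h0, congrArg Subtype.val h1⟩
      | succ s ih =>
        refine ⟨ih.2, ?_⟩
        have h2 := hφ ⟨z (s + 1), hzX B _⟩ ⟨z (s + 2), hzX B _⟩ (hadj _)
        rw [ih.2] at h2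
        rcases hnz (φ ⟨z (s + 2), hzX B _⟩).2 h2 with h3 | h3 | ⟨i, hi, his, h3⟩
        · rw [← ih.1] at h3
          have := hinj (hφi _ _ h3)
          omega
        · exact h3
        · -- A tooth has degree one, unlike a vertex of the ray.
          have h4 := hφ ⟨z (s + 2), hzX B _⟩ ⟨z (s + 3), hzX B _⟩ (hadj _)
          rw [h3] at h4
          have h5 := hnt (φ ⟨z (s + 3), hzX B _⟩).2 h4
          rw [his, ← ih.2] at h5
          have := hinj (hφi _ _ h5)
          omega
    intro i hi
    have h2 := hφ ⟨z (i + 1), hzX B _⟩ ⟨t i, htX B i hi⟩ (htadj i)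
    rw [(hfix i).2] at h2
    rcases hnz (φ ⟨t i, htX B i hi⟩).2 h2 with h3 | h3 | ⟨j, hj, hji, -⟩
    · rw [← (hfix i).1] at h3
      exact absurd (hφi _ _ h3) (ht1 i)
    · rw [← (hfix (i + 1)).2] at h3
      exact absurd (hφi _ _ h3) (ht2 i)
    · rwa [← Subtype.ext hji]
  have hcount := countable_of_locallyFinite hT
  have hunc : Uncountable (Set J) := by
    have := hJinf.to_subtype
    refine ⟨fun hc => ?_⟩
    obtain ⟨e, he⟩ := hc.exists_injective_nat
    exact Function.cantor_injective _ ((Infinite.natEmbedding J).injective.comp he)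
  refine sib_eq_top_of_uncountable (fun B => siblingOfSubtree (X B) (htree B) g (hgX B))
    (fun B => ⟨z 0, hzX B 0⟩) (fun B => ⟨z 1, hzX B 1⟩) fun B B' φ h0 h1 => ?_
  exact (key B B' φ h0 h1).antisymm (key B' B φ.symm (φ.symm_apply_eq.2 h0.symm)
    (φ.symm_apply_eq.2 h1.symm))

end

section

/-! ### Sphere sizes -/

/-- Translations under which a sequence is eventually invariant leave it invariant from one common
index on. -/
theorem exists_uniform_period {α : Type*} (τ : ℕ → α) :
    ∃ J, ∀ t N, (∀ j, N ≤ j → τ j = τ (j + t)) → ∀ j, J ≤ j → τ j = τ (j + t) := by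
  by_cases h : ∃ q J, 0 < q ∧ ∀ j, J ≤ j → τ j = τ (j + q)
  · obtain ⟨q, J, hq, hJ⟩ := h
    have hmul : ∀ k j, J ≤ j → τ j = τ (j + k * q) := by
      intro k j hj
      induction k with
      | zero => simp
      | succ k ih => rw [ih, hJ _ (by omega), Nat.succ_mul, add_assoc]
    -- Compare `j` with `j + N * q`, which is at least `N`.
    refine ⟨J, fun t N ht j hj => ?_⟩
    rw [hmul N j hj, ht _ (by nlinarith), add_right_comm, ← hmul N _ (by omega)]
  · refine ⟨0, fun t N ht j _ => ?_⟩
    rcases Nat.eq_zero_or_pos t with rfl | hpos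
    · rfl
    · exact absurd ⟨t, N, hpos, ht⟩ h

/-- The sphere sizes `B n`, given from index `n` on by the recursion with increments `τ` and
started from a path with `n + 1` vertices, determine `n` even up to an eventual translation. -/
theorem sphere_size_injective {B : ℕ → ℕ → ℕ → ℕ} {τ : ℕ → ℕ → ℕ} {J : ℕ}
    (hB : ∀ n j d, n ≤ j → B n (j + 1) (d + 1) = τ j d + B n j d)
    (hB0 : ∀ n d, B n n d = if d ≤ n then 1 else 0)
    (hJ : ∀ t N, (∀ j, N ≤ j → τ j = τ (j + t)) → ∀ j, J ≤ j → τ j = τ (j + t))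
    {n m t N : ℕ} (hn : J ≤ n) (hm : J ≤ m) (hτn : 1 ≤ τ n 0) (hτm : 1 ≤ τ m 0)
    (h : ∀ j, N ≤ j → B n j = B m (j + t)) : n = m := by
  have hτ : ∀ j, J ≤ j → τ j = τ (j + t) := by
    refine hJ t (N + n + m) fun j hj => funext fun d => ?_
    have h1 := congrFun (h (j + 1) (by omega)) (d + 1)
    have h2 := congrFun (h j (by omega)) d
    rw [hB n j d (by omega), add_right_comm, hB m (j + t) d (by omega), h2] at h1
    omega
  -- Cancelling the increments runs the recursion backwards until one of the two paths is reached.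
  have hdown : ∀ k j, n ≤ j → m ≤ j + t → N ≤ j + k → B n j = B m (j + t) := by
    intro k
    induction k with
    | zero => exact fun j _ _ hN => h j hN
    | succ k ih =>
      intro j hnj hmj hN
      funext d
      have h1 := congrFun (ih (j + 1) (by omega) (by omega) (by omega)) (d + 1)
      rw [hB n j d hnj, add_right_comm, hB m (j + t) d hmj, ← hτ j (by omega)] at h1
      omega
  have hle : ∀ n d, B n n d ≤ 1 := by
    intro n d
    rw [hB0]
    split_ifs <;> omega
  -- Past index `n` the sphere sizes differ from those of a path.
  have htwo : ∀ n, 1 ≤ τ n 0 → ∀ j, n < j → ∃ d, 2 ≤ B n j d := by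
    intro n hn j hj
    obtain ⟨k, rfl⟩ := Nat.exists_eq_add_of_lt hj
    clear hj
    induction k with
    | zero =>
      refine ⟨1, ?_⟩
      rw [add_zero, hB n n 0 le_rfl, hB0, if_pos (Nat.zero_le _)]
      omega
    | succ k ih =>
      obtain ⟨d, hd⟩ := ih
      refine ⟨d + 1, ?_⟩
      rw [← add_assoc n k 1, hB n _ d (by omega)]
      omega
  rcases lt_trichotomy (n + t) m with hlt | heq | hgt
  · obtain ⟨c, rfl⟩ := Nat.exists_eq_add_of_lt hlt
    have h1 := hdown N (n + c + 1) (by omega) (by omega) (by omega)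
    obtain ⟨d, hd⟩ := htwo n hτn (n + c + 1) (by omega)
    rw [h1, show n + c + 1 + t = n + t + c + 1 by omega] at hd
    exact absurd hd (by have := hle (n + t + c + 1) d; omega)
  · have h1 := congrFun (hdown N n le_rfl heq.ge (by omega)) m
    rw [heq, hB0, hB0, if_pos le_rfl] at h1
    split_ifs at h1
    omega
  · have h1 := hdown N n le_rfl hgt.le (by omega)
    obtain ⟨d, hd⟩ := htwo m hτm (n + t) hgt
    rw [← h1] at hd
    exact absurd hd (by have := hle n d; omega)

variable {V : Type u} {T : SimpleGraph V}

/-! ### Thinning out an initial segment of the attracting ray -/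

/-- The vertex set of the subtree of `T` that consists of the ray `R` and of everything beyond its
vertex `R (n + 1)`. -/
def thinned (R : Ray T) (n : ℕ) : Set V := {w | w ∈ Set.range R ∨ Btw T (R 0) (R (n + 1)) w}

theorem ray_mem_thinned (R : Ray T) (n s : ℕ) : R s ∈ thinned R n := Or.inl ⟨s, rfl⟩

theorem thinned_isTree (hT : T.IsTree) (R : Ray T) (n : ℕ) :
    (T.induce (thinned R n)).IsTree := by
  refine induce_isTree hT (r := R 0) (ray_mem_thinned R n 0) fun p w hpw hd hw => ?_
  have hray : ∀ i, w = R i → p ∈ thinned R n := by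
    rintro i rfl
    refine Or.inl ⟨_, (mem_range_of_btw hT R (n := i) ?_).symm⟩
    unfold Btw
    rw [dist_of_adj hpw, hd]
  rcases hw with ⟨i, rfl⟩ | hw
  · exact hray i rfl
  · by_cases hne : R (n + 1) = w
    · exact hray _ hne.symm
    · exact Or.inr (hw.of_child hT hpw hd hne)

/-- The number of vertices of `thinned R n` at distance `d` from `R j` on the side of `R j` that
does not contain `R (j + 1)`. -/
noncomputable def sphereSize (R : Ray T) (n j d : ℕ) : ℕ :=
  Set.ncard {w | w ∈ thinned R n ∧ T.dist w (R j) = d ∧ T.dist w (R (j + 1)) = d + 1}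

/-- The number of vertices at distance `d + 1` from `R (j + 1)` in the tree that hangs off the ray
`R` at `R (j + 1)`. -/
noncomputable def branchSize (R : Ray T) (j d : ℕ) : ℕ :=
  Set.ncard {w | T.dist w (R (j + 1)) = d + 1 ∧ T.dist w (R (j + 2)) = d + 2 ∧
    T.dist w (R j) = d + 2}

/-- The vertices closer to `R (j + 1)` than to `R j` are the descendants of `R (j + 1)`. -/
theorem btw_ray_of_dist (hT : T.IsTree) (R : Ray T) {w : V} {j : ℕ}
    (h : T.dist w (R j) = T.dist w (R (j + 1)) + 1) : Btw T (R 0) (R (j + 1)) w := by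
  have key : T.dist w (R 0) = T.dist w (R (j + 1)) + (j + 1) := by
    induction j with
    | zero => exact h
    | succ j ih =>
      have h1 := dist_no_turn hT (v := w) (ray_adj R (j + 1)).symm (ray_adj R j).symm
        (fun he => by have := R.injective he; omega) h
      rw [ih h1, h]
      omega
  unfold Btw
  rw [ray_dist_zero hT, T.dist_comm (u := R (j + 1)), T.dist_comm (u := R 0), key, add_comm]

theorem finite_sphere [T.LocallyFinite] (hT : T.IsTree) (v : V) (d : ℕ) :
    {w | T.dist w v = d}.Finite :=
  (finite_ball hT v d).subset fun w hw => by
    change T.dist v w ≤ d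
    rw [T.dist_comm]
    exact le_of_eq hw

/-- The side of `R (j + 1)` away from the end of `R` consists of the tree hanging off `R` at
`R (j + 1)` and the corresponding side of `R j`. -/
theorem sphereSize_succ [T.LocallyFinite] (hT : T.IsTree) (R : Ray T) {n j : ℕ} (d : ℕ)
    (hnj : n ≤ j) :
    sphereSize R n (j + 1) (d + 1) = branchSize R j d + sphereSize R n j d := by
  unfold sphereSize branchSize
  rw [← Set.ncard_union_eq ?_ ?_ ?_]
  · congr 1
    ext w
    constructor
    · rintro ⟨hw, h1, h2⟩
      rcases dist_step hT w (ray_adj R j) with h3 | h3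
      · exact Or.inl ⟨h1, h2, by omega⟩
      · exact Or.inr ⟨hw, by omega, h1⟩
    · rintro (⟨h1, h2, h3⟩ | ⟨hw, h1, h2⟩)
      · refine ⟨Or.inr ((ray_btw hT R (Nat.succ_le_succ hnj)).trans hT ?_), h1, h2⟩
        refine btw_ray_of_dist hT R ?_
        omega
      · refine ⟨hw, h2, ?_⟩
        rw [dist_no_turn hT (v := w) (ray_adj R j) (ray_adj R (j + 1))
          (fun he => by have := R.injective he; omega) (by omega), h2]
  · rw [Set.disjoint_left]
    rintro w ⟨-, -, h1⟩ ⟨-, h2, -⟩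
    omega
  · exact (finite_sphere hT (R (j + 1)) (d + 1)).subset fun w hw => hw.1
  · exact (finite_sphere hT (R j) d).subset fun w hw => hw.2.1

/-- On the side of the root, `thinned R n` is the path from `R 0` to `R n`. -/
theorem sphereSize_self (hT : T.IsTree) (R : Ray T) (n d : ℕ) :
    sphereSize R n n d = if d ≤ n then 1 else 0 := by
  have hray : ∀ w, w ∈ thinned R n → T.dist w (R n) = d → T.dist w (R (n + 1)) = d + 1 →
      ∃ i, i + d = n ∧ w = R i := by
    rintro w (⟨i, rfl⟩ | hw) h1 h2
    · rcases Nat.le_total i n with hin | hin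
      · obtain ⟨k, rfl⟩ := Nat.exists_eq_add_of_le hin
        rw [ray_dist hT] at h1
        exact ⟨i, by omega, rfl⟩
      · obtain ⟨k, rfl⟩ := Nat.exists_eq_add_of_le hin
        rw [T.dist_comm, ray_dist hT] at h1
        rcases k with _ | k
        · exact ⟨n, by omega, rfl⟩
        · rw [T.dist_comm, show n + (k + 1) = n + 1 + k by omega, ray_dist hT] at h2
          omega
    · exfalso
      have h3 := dist_tri hT (R 0) (R n) w
      unfold Btw at hw
      rw [ray_dist_zero hT, T.dist_comm (u := R (n + 1)), h2] at hw
      rw [ray_dist_zero hT, T.dist_comm (u := R n), h1] at h3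
      omega
  unfold sphereSize
  split_ifs with hd
  · obtain ⟨i, rfl⟩ := Nat.exists_eq_add_of_le' hd
    rw [Set.ncard_eq_one]
    refine ⟨R i, Set.ext fun w => ⟨?_, ?_⟩⟩
    · rintro ⟨hw, h1, h2⟩
      obtain ⟨i', hi, rfl⟩ := hray w hw h1 h2
      obtain rfl : i' = i := by omega
      rfl
    · rintro rfl
      exact ⟨ray_mem_thinned R _ i, ray_dist hT R i d, by rw [add_assoc, ray_dist hT]⟩
  · refine (congrArg Set.ncard (Set.eq_empty_iff_forall_notMem.2 ?_)).trans (Set.ncard_empty V)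
    rintro w ⟨hw, h1, h2⟩
    obtain ⟨i, hi, -⟩ := hray w hw h1 h2
    omega

theorem one_le_branchSize [T.LocallyFinite] (hT : T.IsTree) (R : Ray T) {k : ℕ} {w : V}
    (hw : T.Adj (R (k + 1)) w) (h1 : w ≠ R k) (h2 : w ≠ R (k + 2)) : 1 ≤ branchSize R k 0 := by
  refine (Set.ncard_pos ((finite_sphere hT (R (k + 1)) 1).subset fun w hw => hw.1)).2 ⟨w, ?_⟩
  have h3 : T.dist w (R (k + 1)) = 1 := dist_of_adj hw.symm
  have h4 : T.dist w (R (k + 1)) = T.dist w w + 1 := by rw [h3, SimpleGraph.dist_self]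
  refine ⟨h3, ?_, ?_⟩
  · rw [dist_no_turn hT hw.symm (ray_adj R (k + 1)) h2 h4, h3]
  · rw [dist_no_turn hT hw.symm (ray_adj R k).symm h1 h4, h3]

/-- An isomorphism that maps the edge from `R j` to `R (j + 1)` to the one from `R j'` to
`R (j' + 1)` preserves the sphere sizes at these vertices. -/
theorem sphereSize_eq_of_iso (hT : T.IsTree) (R : Ray T) {n m j j' : ℕ}
    (φ : T.induce (thinned R n) ≃g T.induce (thinned R m))
    (h0 : (φ ⟨R j, ray_mem_thinned R n j⟩ : V) = R j')
    (h1 : (φ ⟨R (j + 1), ray_mem_thinned R n (j + 1)⟩ : V) = R (j' + 1)) (d : ℕ) :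
    sphereSize R n j d = sphereSize R m j' d := by
  have hdist : ∀ u v : thinned R n, T.dist (φ u : V) (φ v : V) = T.dist (u : V) (v : V) := by
    intro u v
    rw [← induce_dist hT (thinned_isTree hT R m), ← induce_dist hT (thinned_isTree hT R n)]
    exact copy_dist (thinned_isTree hT R n) (thinned_isTree hT R m) φ.toCopy u v
  unfold sphereSize
  refine Set.ncard_congr (fun w hw => (φ ⟨w, hw.1⟩ : V)) ?_ ?_ ?_
  · rintro w ⟨hw, h2, h3⟩
    refine ⟨(φ ⟨w, hw⟩).2, ?_, ?_⟩
    · rw [← h0, hdist, h2]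
    · rw [← h1, hdist, h3]
  · intro u v hu hv huv
    exact congrArg Subtype.val (φ.injective (Subtype.ext huv))
  · rintro w ⟨hw, h2, h3⟩
    obtain ⟨⟨u, hu⟩, huw⟩ := φ.surjective ⟨w, hw⟩
    have huw' : (φ ⟨u, hu⟩ : V) = w := congrArg Subtype.val huw
    refine ⟨u, ⟨hu, ?_, ?_⟩, huw'⟩
    · rw [← h2, ← h0, ← huw', hdist]
    · rw [← h3, ← h1, ← huw', hdist]

/-- If the end of `R` is the only one whose rays have infinitely many branch vertices, then an
isomorphism between thinned out subtrees preserves this end, so it eventually translates `R`. -/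
theorem exists_translation_of_iso (hT : T.IsTree) (R : Ray T)
    (hbr : ∀ M, ∃ k, M ≤ k ∧ ∃ w, T.Adj (R (k + 1)) w ∧ w ≠ R k ∧ w ≠ R (k + 2))
    (hthin : ∀ (z : ℕ → V) (d : ℕ), (∀ s, T.Adj (z s) (z (s + 1))) →
      (∀ s, T.dist (R 0) (z s) = d + s) →
      {s | ∃ w, T.Adj (z (s + 1)) w ∧ w ≠ z s ∧ w ≠ z (s + 2)}.Infinite → z 1 ∈ Set.range R)
    {n m : ℕ} (φ : T.induce (thinned R n) ≃g T.induce (thinned R m)) :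
    ∃ a b, ∀ s, (φ ⟨R (a + s), ray_mem_thinned R n _⟩ : V) = R (b + s) := by
  let Rn : rayGraph.Copy (T.induce (thinned R n)) :=
    ⟨⟨fun s => ⟨R s, ray_mem_thinned R n s⟩, fun h => copy_map_adj R h⟩,
      fun _ _ h => R.injective (congrArg Subtype.val h)⟩
  let Z : Ray T := (SimpleGraph.Copy.induce T (thinned R m)).comp (φ.toCopy.comp Rn)
  have hZ : ∀ s, Z s = (φ ⟨R s, ray_mem_thinned R n s⟩ : V) := fun _ => rfl
  obtain ⟨N, hN⟩ := exists_ray_away hT Z (R 0)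
  have hmem : ∀ j, Z (N + j + 1) ∈ Set.range R := by
    intro j
    refine hthin (fun s => Z (N + j + s)) (T.dist (R 0) (Z N) + j) (fun s => ray_adj Z _)
      (fun s => by rw [add_assoc N, hN, add_assoc]) ?_
    refine Set.infinite_of_forall_exists_gt fun M => ?_
    obtain ⟨k, hk, w, hw, hw1, hw2⟩ := hbr (N + j + M + n + 1)
    obtain ⟨s, rfl⟩ := Nat.exists_eq_add_of_le (show N + j ≤ k by omega)
    have hwX : w ∈ thinned R n := by
      refine Or.inr ((ray_btw hT R (show n + 1 ≤ N + j + s + 1 by omega)).child hT hw ?_)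
      exact dist_no_turn hT (ray_adj R _) hw hw1.symm
        (by rw [ray_dist_zero hT, ray_dist_zero hT])
    have hne : ∀ i, w ≠ R i → (φ ⟨w, hwX⟩ : V) ≠ Z i := fun i hi he =>
      hi (congrArg Subtype.val (φ.injective (Subtype.ext he)))
    -- The image of the branch of `R` at `w` is a branch of `Z`.
    refine ⟨s, ⟨φ ⟨w, hwX⟩, ?_, hne _ hw1, hne _ hw2⟩, by omega⟩
    exact φ.map_adj_iff (v := ⟨R (N + j + s + 1), ray_mem_thinned R n _⟩).2 hw
  refine ⟨N + 1, T.dist (R 0) (Z N) + 1, fun s => ?_⟩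
  obtain ⟨i, hi⟩ := hmem s
  have h1 := hN (s + 1)
  rw [← add_assoc, ← hi, ray_dist_zero hT] at h1
  rw [← hZ, add_right_comm, ← hi, h1]
  congr 1
  omega

/-- If the end of `R` is the only one whose rays have infinitely many branch vertices, then the
subtrees `thinned R n` for suitable `n` are pairwise non-isomorphic siblings. -/
theorem sib_eq_top_of_thin [T.LocallyFinite] (hT : T.IsTree) (f : Emb T) (R : Ray T)
    (hR : ∀ n, ∃ a, ∀ w ∈ Set.range f^[a], Btw T (R 0) (R n) w)
    (hbr : ∀ M, ∃ k, M ≤ k ∧ ∃ w, T.Adj (R (k + 1)) w ∧ w ≠ R k ∧ w ≠ R (k + 2))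
    (hthin : ∀ (z : ℕ → V) (d : ℕ), (∀ s, T.Adj (z s) (z (s + 1))) →
      (∀ s, T.dist (R 0) (z s) = d + s) →
      {s | ∃ w, T.Adj (z (s + 1)) w ∧ w ≠ z s ∧ w ≠ z (s + 2)}.Infinite → z 1 ∈ Set.range R) :
    Sib T = ⊤ := by
  obtain ⟨J, hJ⟩ := exists_uniform_period (branchSize R)
  let I : Set ℕ := {k | J ≤ k ∧ ∃ w, T.Adj (R (k + 1)) w ∧ w ≠ R k ∧ w ≠ R (k + 2)}
  have hI : I.Infinite := Set.infinite_of_forall_exists_gt fun M => by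
    obtain ⟨k, hk, hw⟩ := hbr (J + M + 1)
    exact ⟨k, ⟨by omega, hw⟩, by omega⟩
  have := hI.to_subtype
  choose a ha using hR
  choose g hg using fun n => exists_iterate_copy f (a n)
  have hgX : ∀ n, ∀ w ∈ Set.range (g (n + 1)), w ∈ thinned R n := by
    intro n w hw
    rw [hg] at hw
    exact Or.inr (ha _ w hw)
  have hτ : ∀ k : I, 1 ≤ branchSize R k 0 := by
    rintro ⟨k, -, w, hw, hw1, hw2⟩
    exact one_le_branchSize hT R hw hw1 hw2
  have key : ∀ (n m : I) (φ : T.induce (thinned R n) ≃g T.induce (thinned R m)) (b c : ℕ),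
      (∀ s, (φ ⟨R (b + s), ray_mem_thinned R n _⟩ : V) = R (c + s)) → b ≤ c →
      (n : ℕ) = m := by
    intro n m φ b c h hbc
    obtain ⟨t, rfl⟩ := Nat.exists_eq_add_of_le hbc
    refine sphere_size_injective (fun n j d => sphereSize_succ hT R d) (sphereSize_self hT R) hJ
      n.2.1 m.2.1 (hτ n) (hτ m) (t := t) (N := b) fun j hj => funext fun d => ?_
    obtain ⟨s, rfl⟩ := Nat.exists_eq_add_of_le hj
    refine sphereSize_eq_of_iso hT R φ ?_ ?_ d
    · rw [h, add_right_comm]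
    · have := h (s + 1)
      rw [show b + t + (s + 1) = b + s + t + 1 by omega] at this
      exact this
  refine sib_eq_top_of_injective (fun n : I => siblingOfSubtree (thinned R n)
    (thinned_isTree hT R n) (g (n + 1)) (hgX n)) ?_
  rintro n m ⟨φ⟩
  change T.induce (thinned R n) ≃g T.induce (thinned R m) at φ
  obtain ⟨b, c, h⟩ := exists_translation_of_iso hT R hbr hthin φ
  apply Subtype.ext
  rcases Nat.le_total b c with hbc | hbc
  · exact key n m φ b c h hbc
  · refine (key m n φ.symm c b (fun s => ?_) hbc).symm
    have h1 : φ ⟨R (b + s), ray_mem_thinned R n _⟩ = ⟨R (c + s), ray_mem_thinned R m _⟩ :=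
      Subtype.ext (h s)
    rw [← h1, φ.symm_apply_apply]

/-! ### The dichotomy -/

theorem sib_eq_top [T.LocallyFinite] (hT : T.IsTree) (f : Emb T) (hf : ¬ Function.Surjective f)
    (hyp : ¬ IsHyperbolic f) (hray : ¬ IsRay T) : Sib T = ⊤ := by
  have hV : Infinite V := by
    by_contra hfin
    rw [not_infinite_iff_finite] at hfin
    exact hf (Finite.surjective_of_injective f.injective)
  obtain ⟨R, hR⟩ := exists_attracting_ray hT f (exists_notMem_range_iterate hT f hf hyp)
  by_cases hcomb : ∃ (z : ℕ → V) (d : ℕ), (∀ s, T.Adj (z s) (z (s + 1))) ∧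
      (∀ s, T.dist (R 0) (z s) = d + s) ∧ z 1 ∉ Set.range R ∧
      {s | ∃ w, T.Adj (z (s + 1)) w ∧ w ≠ z s ∧ w ≠ z (s + 2)}.Infinite
  · obtain ⟨z, d, hadj, hd, hz, hbr⟩ := hcomb
    exact sib_eq_top_of_comb hT f R hR z d hadj hd hz hbr
  · refine sib_eq_top_of_thin hT f R hR (exists_branch hT hray f R hR) fun z d hadj hd hbr => ?_
    by_contra hz
    exact hcomb ⟨z, d, hadj, hd, hz, hbr⟩

end

end TreeSiblings

theorem mainTheorem2 {V : Type u} (T : SimpleGraph V) [T.LocallyFinite] (hT : T.IsTree)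
    (hhyp : ¬ ∃ g : TreeSiblings.Emb T, TreeSiblings.IsHyperbolic g) :
    (TreeSiblings.Sib T = 1 ∨ TreeSiblings.Sib T = ⊤) ∧
    ((∃ f : TreeSiblings.Emb T, ¬ Function.Surjective f) → ¬ TreeSiblings.IsRay T →
      TreeSiblings.Sib T = ⊤) := by
  have key : ∀ f : TreeSiblings.Emb T, ¬ Function.Surjective f → ¬ TreeSiblings.IsRay T →
      TreeSiblings.Sib T = ⊤ := fun f hf hray =>
    TreeSiblings.sib_eq_top hT f hf (fun h => hhyp ⟨f, h⟩) hray
  refine ⟨?_, fun ⟨f, hf⟩ hray => key f hf hray⟩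
  by_cases hsurj : ∀ f : TreeSiblings.Emb T, Function.Surjective f
  · exact Or.inl (TreeSiblings.sib_eq_one_of_surjective hT hsurj)
  · push Not at hsurj
    obtain ⟨f, hf⟩ := hsurj
    by_cases hray : TreeSiblings.IsRay T
    · exact Or.inl (TreeSiblings.sib_eq_one_of_isRay hT hray)
    · exact Or.inr (key f hf hray)
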